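/- Let $n\ge 1$ be an integer, let $\mathbb{CP}_n$ be the complex projective space of complex lines through the origin in $\mathbb C^{n+1}$ (with the quotient topology from $\mathbb C^{n+1}\setminus\{0\}$), and let $S^{2n+1}$ be the unit sphere in $\mathbb R^{2n+2}$. For every choice of base points $x\in\mathbb{CP}_n$ and $y\in S^{2n+1}$: * $\pi_j(\mathbb{CP}_n,x)=0$ for $j<2$, i.e. $\mathbb{CP}_n$ is path connected ($j=0$) and its fundamental group is trivial ($j=1$); * $\pi_2(\mathbb{CP}_n,x)\cong\mathbb Z$ as groups; * $\pi_j(\mathbb{CP}_n,x)\cong\pi_j(S^{2n+1},y)$ as groups for every $j>2$. -/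

import Mathlib

open scoped Topology

/-- The quotient topology on a projective space: `Projectivization K V` is the quotient of
`V \ {0}` (with the subspace topology) by scalar multiplication by units of `K`. -/
instance Projectivization.quotientTopologicalSpace (K V : Type*) [DivisionRing K]
    [AddCommGroup V] [Module K V] [TopologicalSpace V] :
    TopologicalSpace (Projectivization K V) :=
  inferInstanceAs (TopologicalSpace (Quotient (projectivizationSetoid K V)))

/-- The complex projective space `CP_n` of complex lines through the origin in `ℂ^(n+1)`. -/
abbrev ComplexProjectiveSpace (n : ℕ) : Type :=
  Projectivization ℂ (EuclideanSpace ℂ (Fin (n + 1)))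

/-- The standard unit sphere `S^m` in the Euclidean space `ℝ^(m+1)`. -/
abbrev StandardSphere (m : ℕ) : Type :=
  Metric.sphere (0 : EuclideanSpace ℝ (Fin (m + 1))) 1

/-! The Hopf map from the unit sphere of `V` to `ℙ ℂ V` has circles as fibers and lifts homotopies
(`exists_homotopy_lift`). The long exact sequence of this fibration would give the theorem; here its
relevant pieces are proved directly on cubes.

A loop of dimension `j` in projective space lifts to a cube in the sphere that is constant on every
face but one, and that last face maps into a single fiber, hence is described by a circle-valued
function `u`. If the face has dimension different from `1`, then `u` has a logarithm vanishing on
the boundary (`exists_circle_exp_lift_boundary`), and rotating the lift by a multiple of it makes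
the lift a loop. The same trick applied to a lifted null-homotopy gives injectivity. So the Hopf map
induces isomorphisms for `j > 2`, and loops lift to loops for `j = 1`.

For `j = 2` the last face is an edge and `u` may wind around the fiber. Its winding number gives the
isomorphism with `ℤ`: it is injective because the sphere has trivial second homotopy group, and
surjective because loops in the sphere contract. Both vanish since the sphere has dimension at least
`3`: a smoothed low-dimensional cube misses a line (`genLoop_sphere_homotopic_const`). -/

open scoped unitInterval Topology.Homotopy LinearAlgebra.Projectivization

/-! ### The Hopf map, its homotopy lifting property, and circle rotations -/

section Hopf

variable {V : Type*} [NormedAddCommGroup V] [InnerProductSpace ℂ V]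

/-- The projection from the unit sphere of a complex inner product space to its projective
space. -/
noncomputable def hopf : C(Metric.sphere (0 : V) 1, ℙ ℂ V) where
  toFun v := Projectivization.mk ℂ (v : V) (ne_zero_of_mem_unit_sphere v)
  continuous_toFun := by
    have : Continuous (fun v : {v : V // v ≠ 0} ↦ Projectivization.mk' ℂ v) :=
      continuous_quotient_mk'
    exact this.comp (f := fun v : Metric.sphere (0 : V) 1 ↦
      (⟨v, ne_zero_of_mem_unit_sphere v⟩ : {v : V // v ≠ 0})) (by fun_prop)

theorem hopf_surjective : Function.Surjective (hopf : C(Metric.sphere (0 : V) 1, ℙ ℂ V)) := by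
  intro ℓ
  induction ℓ using Projectivization.ind with
  | h v hv =>
    refine ⟨⟨((‖v‖⁻¹ : ℝ) : ℂ) • v, ?_⟩, ?_⟩
    · simp [norm_smul, inv_mul_cancel₀ (norm_ne_zero_iff.2 hv)]
    · refine (Projectivization.mk_eq_mk_iff' ℂ _ _ _ _).2 ⟨((‖v‖⁻¹ : ℝ) : ℂ), rfl⟩

/-- The orthogonal projection onto the line spanned by a nonzero vector. -/
noncomputable def spanProj (w : V) : V →L[ℂ] V :=
  ((‖w‖ ^ 2 : ℝ) : ℂ)⁻¹ • (innerSL ℂ w).smulRight w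

theorem spanProj_apply (w v : V) :
    spanProj w v = (((‖w‖ ^ 2 : ℝ) : ℂ)⁻¹ * inner ℂ w v) • w := by
  simp [spanProj, smul_smul]

theorem spanProj_smul {c : ℂ} (hc : c ≠ 0) (w : V) : spanProj (c • w) = spanProj w := by
  ext v
  rw [spanProj_apply, spanProj_apply, smul_smul]
  congr 1
  have hn : ((‖c • w‖ ^ 2 : ℝ) : ℂ) = c * (starRingEnd ℂ) c * ((‖w‖ ^ 2 : ℝ) : ℂ) := by
    rw [norm_smul, mul_pow, Complex.mul_conj, Complex.normSq_eq_norm_sq]; push_cast; ring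
  have hc' : (starRingEnd ℂ) c ≠ 0 := by simpa using hc
  rw [hn, inner_smul_left]
  field_simp

theorem continuous_spanProj : Continuous fun w : {w : V // w ≠ 0} ↦ spanProj (w : V) := by
  unfold spanProj
  refine Continuous.smul (M := ℂ) ?_ ?_
  · refine Continuous.inv₀ (by fun_prop) fun w ↦ ?_
    simpa using w.2
  · have : Continuous fun w : V ↦ ContinuousLinearMap.smulRightL ℂ V V (innerSL ℂ w) w := by
      fun_prop
    exact this.comp continuous_subtype_val

/-- The orthogonal projection onto a line, as a function on projective space. -/
noncomputable def lineProj : C(ℙ ℂ V, V →L[ℂ] V) where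
  toFun ℓ := Projectivization.lift (fun w : {w : V // w ≠ 0} ↦ spanProj (w : V))
    (by
      rintro ⟨a, ha⟩ ⟨b, hb⟩ c (rfl : a = c • b)
      exact spanProj_smul (fun h ↦ ha (by simp [h])) b) ℓ
  continuous_toFun :=
    (isQuotientMap_quotient_mk' (s := projectivizationSetoid ℂ V)).continuous_iff.2
      continuous_spanProj

theorem lineProj_hopf (v : Metric.sphere (0 : V) 1) (w : V) :
    lineProj (hopf v) w = inner ℂ (v : V) w • (v : V) := by
  change spanProj (v : V) w = _
  simp [spanProj_apply]

theorem lineProj_hopf_self (v : Metric.sphere (0 : V) 1) : lineProj (hopf v) (v : V) = v := by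
  simp [lineProj_hopf]

theorem hopf_eq_of_smul_eq {v w : Metric.sphere (0 : V) 1} {c : ℂ} (h : (w : V) = c • (v : V)) :
    hopf w = hopf v :=
  (Projectivization.mk_eq_mk_iff' ℂ _ _ _ _).2 ⟨c, h.symm⟩

/-- Both points determine the same orthogonal projector, which fixes `w`. The ratio of two points of
a fiber is thus an inner product, continuous in both. -/
theorem inner_smul_eq_of_hopf_eq {v w : Metric.sphere (0 : V) 1} (h : hopf v = hopf w) :
    inner ℂ (v : V) (w : V) • (v : V) = w := by
  rw [← lineProj_hopf, h, lineProj_hopf_self]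

theorem norm_inner_of_hopf_eq {v w : Metric.sphere (0 : V) 1} (h : hopf v = hopf w) :
    ‖inner ℂ (v : V) (w : V)‖ = 1 := by
  have := congrArg norm (inner_smul_eq_of_hopf_eq h)
  simpa [norm_smul] using this

variable {Z : Type*} [TopologicalSpace Z]

/-- Normalization of a nowhere vanishing map to a normed space. -/
noncomputable def normalizeMap {W : Type*} [NormedAddCommGroup W] [NormedSpace ℝ W]
    (G : C(Z, W)) (hG : ∀ z, G z ≠ 0) : C(Z, Metric.sphere (0 : W) 1) where
  toFun z := ⟨‖G z‖⁻¹ • G z, by simp [norm_smul, inv_mul_cancel₀ (norm_ne_zero_iff.2 (hG z))]⟩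
  continuous_toFun := by
    refine Continuous.subtype_mk (Continuous.smul (Continuous.inv₀ (by fun_prop) ?_)
      (by fun_prop)) _
    exact fun z ↦ norm_ne_zero_iff.2 (hG z)

@[simp]
theorem normalizeMap_coe {W : Type*} [NormedAddCommGroup W] [NormedSpace ℝ W]
    (G : C(Z, W)) (hG : ∀ z, G z ≠ 0) (z : Z) :
    (normalizeMap G hG z : W) = ‖G z‖⁻¹ • G z := rfl

/-- A map to the sphere lying over `K'` is moved to one lying over a nearby map `K`. -/
theorem exists_transport (F : C(Z, Metric.sphere (0 : V) 1)) (K : C(Z, ℙ ℂ V))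
    (h : ∀ z, ‖lineProj (K z) - lineProj (hopf (F z))‖ < 1) :
    ∃ F' : C(Z, Metric.sphere (0 : V) 1), (∀ z, hopf (F' z) = K z) ∧
      ∀ z, hopf (F z) = K z → F' z = F z := by
  -- Project `F z` onto the line `K z`. If the result were zero, the difference of the two
  -- projectors would have norm at least `1` on the unit vector `F z`.
  let G : C(Z, V) := ⟨fun z ↦ lineProj (K z) (F z : V), by fun_prop⟩
  have hG : ∀ z, G z ≠ 0 := by
    intro z hz
    have h1 := (lineProj (K z) - lineProj (hopf (F z))).le_opNorm (F z : V)
    have h2 : lineProj (K z) (F z : V) = 0 := hz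
    rw [sub_apply, h2, lineProj_hopf_self] at h1
    simp at h1
    linarith [h z]
  let : NormedSpace ℝ V := NormedSpace.restrictScalars ℝ ℂ V
  refine ⟨normalizeMap G hG, fun z ↦ ?_, fun z hz ↦ ?_⟩
  · obtain ⟨v, hv⟩ := hopf_surjective (K z)
    rw [← hv]
    refine hopf_eq_of_smul_eq (c := ((‖G z‖⁻¹ : ℝ) : ℂ) * inner ℂ (v : V) (F z : V)) ?_
    have : G z = inner ℂ (v : V) (F z : V) • (v : V) := by
      rw [← lineProj_hopf, hv]; rfl
    rw [mul_smul, ← this]; rfl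
  · have : G z = F z := by
      change lineProj (K z) (F z : V) = _
      rw [← hz, lineProj_hopf_self]
    ext1
    simp [this]

/-- The homotopy lifting property of the Hopf map over compact spaces; the lift is stationary
where the homotopy is. -/
theorem exists_homotopy_lift {Y : Type*} [UniformSpace Y] [CompactSpace Y]
    (H : C(Y × I, ℙ ℂ V)) (F₀ : C(Y, Metric.sphere (0 : V) 1))
    (h₀ : ∀ y, hopf (F₀ y) = H (y, 0)) :
    ∃ F : C(Y × I, Metric.sphere (0 : V) 1), (∀ z, hopf (F z) = H z) ∧
      (∀ y, F (y, 0) = F₀ y) ∧ ∀ y, (∀ t, H (y, t) = H (y, 0)) → ∀ t, F (y, t) = F₀ y := by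
  have huc : UniformContinuous fun z ↦ lineProj (H z) :=
    CompactSpace.uniformContinuous_of_continuous (by fun_prop)
  have hev := huc (Metric.dist_mem_uniformity one_pos)
  obtain ⟨⟨A, ε⟩, ⟨hA, hε⟩, hAε⟩ :=
    ((Filter.basis_sets _).uniformity_prod Metric.uniformity_basis_dist).mem_iff.1 hev
  have key : ∀ (y : Y) (s t : I), dist s t < ε →
      ‖lineProj (H (y, s)) - lineProj (H (y, t))‖ < 1 := by
    intro y s t hst
    rw [← dist_eq_norm]
    exact hAε (a := ((y, s), (y, t))) ⟨refl_mem_uniformity hA, hst⟩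
  obtain ⟨N, hN⟩ := exists_nat_gt ε⁻¹
  have hN0 : (0 : ℝ) < N := (inv_pos.2 hε).trans hN
  let a : ℕ → I := fun k ↦ Set.projIcc 0 1 zero_le_one ((k : ℝ) / N)
  have ha : ∀ k t, dist (min t (a (k + 1))) (min t (a k)) < ε := by
    intro k t
    have h1 : dist (a (k + 1)) (a k) < ε := by
      have : |(a (k + 1) : ℝ) - a k| ≤ |((k + 1 : ℕ) : ℝ) / N - (k : ℝ) / N| :=
        Set.abs_projIcc_sub_projIcc _
      rw [Subtype.dist_eq, Real.dist_eq]
      refine lt_of_le_of_lt this ?_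
      rw [← sub_div]
      push_cast
      rw [add_sub_cancel_left, abs_of_pos (by positivity), one_div]
      exact inv_lt_of_inv_lt₀ hε hN
    refine lt_of_le_of_lt ?_ h1
    rw [Subtype.dist_eq, Subtype.dist_eq, Real.dist_eq, Real.dist_eq]
    have := abs_min_sub_min_le_max (t : ℝ) (a (k + 1)) t (a k)
    simpa using this
  -- The time interval is cut into `N` pieces shorter than `ε`, which is uniform in `y` by
  -- compactness. Stage `k` lifts the homotopy frozen after time `a k`; `exists_transport` leads to
  -- the next stage.
  have step : ∀ k : ℕ, ∃ F : C(Y × I, Metric.sphere (0 : V) 1),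
      (∀ y t, hopf (F (y, t)) = H (y, min t (a k))) ∧
      (∀ y, F (y, 0) = F₀ y) ∧ ∀ y, (∀ t, H (y, t) = H (y, 0)) → ∀ t, F (y, t) = F₀ y := by
    intro k
    induction k with
    | zero =>
      refine ⟨F₀.comp ⟨Prod.fst, continuous_fst⟩, fun y t ↦ ?_, fun y ↦ rfl, fun y _ t ↦ rfl⟩
      have : a 0 = 0 := by simp [a]
      simp [h₀, this]
    | succ k ih =>
      obtain ⟨F, hF, hF0, hFs⟩ := ih
      obtain ⟨F', hF', hFF'⟩ := exists_transport F
        (H.comp ⟨fun z : Y × I ↦ (z.1, min z.2 (a (k + 1))), by fun_prop⟩) (by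
          rintro ⟨y, t⟩
          rw [hF]
          exact key y _ _ (ha k t))
      refine ⟨F', fun y t ↦ hF' (y, t), fun y ↦ ?_, fun y hy t ↦ ?_⟩
      · rw [hFF', hF0]
        rw [hF]
        simp
      · rw [hFF', hFs y hy]
        rw [hF]
        simp only [ContinuousMap.comp_apply, ContinuousMap.coe_mk]
        rw [hy, hy (min t _)]
  obtain ⟨F, hF, hF'⟩ := step N
  refine ⟨F, fun z ↦ ?_, hF'⟩
  have : a N = 1 := by simp [a, div_self hN0.ne']
  rw [show z = (z.1, z.2) from rfl, hF, this, min_eq_left unitInterval.le_one']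

/-- Rotation of a map to the sphere by a map to the circle. -/
noncomputable def rot (u : C(Z, Circle)) (F : C(Z, Metric.sphere (0 : V) 1)) :
    C(Z, Metric.sphere (0 : V) 1) where
  toFun z := ⟨(u z : ℂ) • (F z : V), by
    rw [mem_sphere_zero_iff_norm, norm_smul, Circle.norm_coe, one_mul, norm_eq_of_mem_sphere]⟩
  continuous_toFun := by fun_prop

@[simp]
theorem rot_coe (u : C(Z, Circle)) (F : C(Z, Metric.sphere (0 : V) 1)) (z : Z) :
    (rot u F z : V) = (u z : ℂ) • (F z : V) := rfl

@[simp]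
theorem hopf_rot (u : C(Z, Circle)) (F : C(Z, Metric.sphere (0 : V) 1)) (z : Z) :
    hopf (rot u F z) = hopf (F z) :=
  hopf_eq_of_smul_eq (rot_coe u F z)

theorem rot_eq_of_eq_one {u : C(Z, Circle)} {F : C(Z, Metric.sphere (0 : V) 1)} {z : Z}
    (h : u z = 1) : rot u F z = F z := by
  ext1; simp [h]

theorem rot_eq_of_smul_eq {u : C(Z, Circle)} {F : C(Z, Metric.sphere (0 : V) 1)} {z : Z}
    {c : Circle} {v : Metric.sphere (0 : V) 1} (hF : (F z : V) = (c : ℂ) • (v : V))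
    (hu : u z * c = 1) : rot u F z = v := by
  ext1
  rw [rot_coe, hF, smul_smul, ← Circle.coe_mul, hu, Circle.coe_one, one_smul]

theorem circle_eq_one_of_smul_eq {c : Circle} {v : Metric.sphere (0 : V) 1}
    (h : (v : V) = (c : ℂ) • (v : V)) : c = 1 := by
  have : ((c : ℂ) - 1) • (v : V) = 0 := by rw [sub_smul, ← h, one_smul, sub_self]
  rcases smul_eq_zero.1 this with h | h
  · exact Circle.ext (by simpa using sub_eq_zero.1 h)
  · exact absurd h (ne_zero_of_mem_unit_sphere v)

theorem exists_rot_eq (F F' : C(Z, Metric.sphere (0 : V) 1)) (h : ∀ z, hopf (F z) = hopf (F' z)) :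
    ∃ u : C(Z, Circle), rot u F = F' := by
  refine ⟨⟨fun z ↦ ⟨inner ℂ (F z : V) (F' z : V), ?_⟩, ?_⟩, ?_⟩
  · simpa [Submonoid.unitSphere] using norm_inner_of_hopf_eq (h z)
  · exact Continuous.subtype_mk (by fun_prop) _
  · ext z
    exact inner_smul_eq_of_hopf_eq (h z)

end Hopf

/-! ### Logarithms of circle-valued maps on cubes -/

section CircleLift

/-- Scaling contracts the cube to `0`, so `u` is the end of a homotopy starting at a constant, and
the covering `Circle.exp` lifts it. -/
theorem exists_circle_exp_lift {M : Type*} (u : C(I^M, Circle)) :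
    ∃ θ : C(I^M, ℝ), ∀ s, Circle.exp (θ s) = u s := by
  let H : C(I × (I^M), Circle) := u.comp ⟨fun z k ↦ z.1 * z.2 k, by fun_prop⟩
  have h0 : ∀ s, H (0, s) = Circle.exp (ContinuousMap.const (I^M) (Complex.arg (u 0)) s) := by
    intro s
    rw [ContinuousMap.const_apply, Circle.exp_arg]
    simp only [H, ContinuousMap.comp_apply, ContinuousMap.coe_mk, zero_mul]
    rfl
  refine ⟨(Circle.isCoveringMap_exp.liftHomotopy H _ h0).comp ⟨fun s ↦ (1, s), by fun_prop⟩,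
    fun s ↦ ?_⟩
  have := congrFun (Circle.isCoveringMap_exp.liftHomotopy_lifts H _ h0) (1, s)
  refine this.trans ?_
  simp only [H, ContinuousMap.comp_apply, ContinuousMap.coe_mk, one_mul]

theorem eq_of_circle_exp_eq_one (γ : C(I, ℝ)) (h : ∀ t, Circle.exp (γ t) = 1) : γ 0 = γ 1 :=
  Circle.isCoveringMap_exp.const_of_comp γ.continuous (fun a b ↦ (h a).trans (h b).symm) 0 1

/-- A map from a cube of dimension different from `1` to the circle, equal to `1` on the boundary,
has a logarithm vanishing on the boundary. -/
theorem exists_circle_exp_lift_boundary {M : Type*} (hM : IsEmpty M ∨ Nontrivial M)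
    (u : C(I^M, Circle)) (hu : ∀ s ∈ Cube.boundary M, u s = 1) :
    ∃ θ : C(I^M, ℝ), (∀ s, Circle.exp (θ s) = u s) ∧ ∀ s ∈ Cube.boundary M, θ s = 0 := by
  classical
  obtain ⟨θ, hθ⟩ := exists_circle_exp_lift u
  rcases hM with hM | hM
  · exact ⟨θ, hθ, fun s ⟨i, _⟩ ↦ isEmptyElim i⟩
  have hz : Circle.exp (θ 0) = 1 := by
    obtain ⟨i⟩ := hM.to_nonempty
    rw [hθ, hu 0 ⟨i, Or.inl rfl⟩]
  refine ⟨θ - ContinuousMap.const _ (θ 0), fun s ↦ ?_, ?_⟩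
  · simp [Circle.exp_sub, hz, hθ s]
  rintro s ⟨i, hi⟩
  -- A second coordinate `k` joins `s` to `0` within the boundary: first shrink coordinate `k`,
  -- staying on the face of `i`; then shrink the rest, staying on the face `s k = 0`. Along this
  -- path `θ` takes values in a discrete set. In dimension `1` the boundary is disconnected and this
  -- fails.
  obtain ⟨k, hki⟩ := exists_ne i
  have h1 := eq_of_circle_exp_eq_one (θ.comp ⟨fun t : I ↦ Function.update s k (t * s k),
    by fun_prop⟩) (by
      intro t
      rw [ContinuousMap.comp_apply, hθ]
      exact hu _ ⟨i, by simpa [Function.update_of_ne hki.symm] using hi⟩)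
  have h2 := eq_of_circle_exp_eq_one (θ.comp ⟨fun (t : I) j ↦ t * Function.update s k 0 j,
    by fun_prop⟩) (by
      intro t
      rw [ContinuousMap.comp_apply, hθ]
      exact hu _ ⟨k, by simp⟩)
  simp only [ContinuousMap.comp_apply, ContinuousMap.coe_mk, zero_mul, one_mul,
    Function.update_eq_self] at h1 h2
  simp only [ContinuousMap.sub_apply, ContinuousMap.const_apply]
  rw [← h1, ← h2]
  exact sub_self _

end CircleLift

/-! ### Low-dimensional homotopy groups of spheres -/

section Sphere

variable {W : Type*} [NormedAddCommGroup W] [NormedSpace ℝ W]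

/-- The affine homotopy between maps to the complement of the origin, normalized. -/
theorem normalizeMap_homotopicRel {Z : Type*} [TopologicalSpace Z] {A : Set Z} {P Q : C(Z, W)}
    (hP : ∀ z, P z ≠ 0) (hQ : ∀ z, Q z ≠ 0)
    (h : ∀ z (t : I), (1 - (t : ℝ)) • P z + (t : ℝ) • Q z ≠ 0) (hA : ∀ z ∈ A, P z = Q z) :
    (normalizeMap P hP).HomotopicRel (normalizeMap Q hQ) A := by
  refine ⟨⟨⟨normalizeMap (Z := I × Z)
    ⟨fun z ↦ (1 - (z.1 : ℝ)) • P z.2 + (z.1 : ℝ) • Q z.2, by fun_prop⟩ fun z ↦ h z.2 z.1,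
      fun z ↦ ?_, fun z ↦ ?_⟩, fun t z hz ↦ ?_⟩⟩
  · ext1; simp
  · ext1; simp
  · ext1
    simp [← hA z hz, ← add_smul]

/-- Smooth approximation of a map on a cube that is constant on the boundary. -/
theorem exists_contDiff_approx {N : Type*} [Fintype N] (f : C(I^N, W)) (y₀ : W)
    (hf : ∀ s ∈ Cube.boundary N, f s = y₀) {ε : ℝ} (hε : 0 < ε) :
    ∃ g : (N → ℝ) → W, ContDiff ℝ 1 g ∧ (∀ s : I^N, dist (g fun i ↦ s i) (f s) < ε) ∧
      ∀ s ∈ Cube.boundary N, g (fun i ↦ s i) = y₀ := by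
  let e : C(N → ℝ, W) := f.comp ⟨fun x i ↦ Set.projIcc 0 1 zero_le_one (x i), by fun_prop⟩
  have he : ∀ s : I^N, e (fun i ↦ s i) = f s := by
    intro s
    simp [e]
  let B : Set (N → ℝ) := ⋃ i, {x | x i = 0 ∨ x i = 1}
  have hB : IsClosed B := isClosed_iUnion_of_finite fun i ↦
    (isClosed_eq (by fun_prop) (by fun_prop)).union (isClosed_eq (by fun_prop) (by fun_prop))
  have heB : ∀ x ∈ B, e x = y₀ := by
    intro x hx
    obtain ⟨i, hi⟩ := Set.mem_iUnion.1 hx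
    refine hf _ ⟨i, ?_⟩
    rcases hi with hi | hi <;> simp [hi]
  -- The constraint at `x` is convex: be `ε`-close to `e x`, and equal `y₀` if `x ∈ B`. The constant
  -- `e x` satisfies it near `x`, since `B` is closed and `e = y₀` on `B`; a partition of unity then
  -- glues.
  obtain ⟨g, hg⟩ := exists_contMDiffMap_forall_mem_convex_of_local_const (n := 1)
    (modelWithCornersSelf ℝ (N → ℝ)) (t := fun x ↦ Metric.ball (e x) ε ∩ {w | x ∈ B → w = y₀})
    (fun x ↦ by
      refine (convex_ball _ _).inter ?_
      by_cases hx : x ∈ B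
      · simp [hx]
      · simpa [hx] using convex_univ (𝕜 := ℝ) (E := W))
    (fun x ↦ by
      refine ⟨e x, ?_⟩
      have h1 : ∀ᶠ y in 𝓝 x, e x ∈ Metric.ball (e y) ε := by
        filter_upwards [e.continuous.continuousAt.eventually (Metric.ball_mem_nhds _ hε)] with y hy
        rwa [Metric.mem_ball']
      have h2 : ∀ᶠ y in 𝓝 x, y ∈ B → e x = y₀ := by
        by_cases hx : x ∈ B
        · exact Filter.Eventually.of_forall fun y _ ↦ heB x hx
        · filter_upwards [hB.isOpen_compl.mem_nhds hx] with y hy hy'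
          exact absurd hy' hy
      exact h1.and h2)
  refine ⟨g, g.contMDiff.contDiff, fun s ↦ ?_, fun s hs ↦ ?_⟩
  · rw [← he]; exact (hg _).1
  · obtain ⟨i, hi⟩ := hs
    exact (hg _).2 (Set.mem_iUnion.2 ⟨i, by simpa using hi⟩)

/-- A small multiple of a bump function moves the interior of a low-dimensional cube off a line. -/
theorem exists_perturbation_avoiding_line [FiniteDimensional ℝ W] {N : Type*} [Fintype N]
    (hN : Fintype.card N + 1 < Module.finrank ℝ W) {g : (N → ℝ) → W} (hg : ContDiff ℝ 1 g)
    (y₀ : W) {ε : ℝ} (hε : 0 < ε) :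
    ∃ w : W, ‖w‖ < ε ∧ ∀ x : N → ℝ, (∀ i, x i ∈ Set.Ioo (0 : ℝ) 1) → ∀ r : ℝ,
      g x + (∏ i, x i * (1 - x i)) • w ≠ r • y₀ := by
  let U : Set ((N → ℝ) × ℝ) := (Set.univ.pi fun _ ↦ Set.Ioo (0 : ℝ) 1) ×ˢ Set.univ
  have hU : Convex ℝ U := (convex_pi fun _ _ ↦ convex_Ioo _ _).prod convex_univ
  have hpos : ∀ x : N → ℝ, (∀ i, x i ∈ Set.Ioo (0 : ℝ) 1) → ∏ i, x i * (1 - x i) ≠ 0 := by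
    intro x hx
    refine Finset.prod_ne_zero_iff.2 fun i _ ↦ ?_
    exact (mul_pos (hx i).1 (sub_pos.2 (hx i).2)).ne'
  -- `Φ (x, r)` is the only `w` for which the perturbed map takes the value `r • y₀` at `x`. These
  -- bad vectors form a `C¹` image of a set of dimension `card N + 1 < finrank W`, so they have
  -- dense complement.
  let Φ : (N → ℝ) × ℝ → W := fun p ↦ (∏ i, p.1 i * (1 - p.1 i))⁻¹ • (p.2 • y₀ - g p.1)
  have hΦ : ContDiffOn ℝ 1 Φ U := by
    refine ContDiffOn.smul (ContDiffOn.inv ?_ fun p hp ↦ hpos p.1 fun i ↦ hp.1 i trivial) ?_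
    · exact (contDiff_prod fun i _ ↦ by fun_prop).contDiffOn
    · exact ((contDiff_snd.smul contDiff_const).sub (hg.comp contDiff_fst)).contDiffOn
  have hd : Dense (Φ '' U)ᶜ := by
    refine hΦ.dense_compl_image_of_dimH_lt_finrank hU subset_rfl ?_
    refine (dimH_mono (Set.subset_univ U)).trans_lt ?_
    rw [Real.dimH_univ_eq_finrank]
    simpa using mod_cast hN
  obtain ⟨w, hw, hwε⟩ := hd.exists_dist_lt 0 hε
  refine ⟨w, by simpa using hwε, fun x hx r h ↦ hw ⟨(x, r), ⟨fun i _ ↦ hx i, trivial⟩, ?_⟩⟩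
  change (∏ i, x i * (1 - x i))⁻¹ • (r • y₀ - g x) = w
  rw [← h, add_sub_cancel_left, smul_smul, inv_mul_cancel₀ (hpos x hx), one_smul]

/-- Generalized loops of dimension less than that of a sphere are null-homotopic. -/
theorem genLoop_sphere_homotopic_const [FiniteDimensional ℝ W] {N : Type*} [Fintype N]
    (hN : Fintype.card N + 1 < Module.finrank ℝ W) {y₀ : Metric.sphere (0 : W) 1}
    (f : Ω^ N (Metric.sphere (0 : W) 1) y₀) : GenLoop.Homotopic f GenLoop.const := by
  let f' : C(I^N, W) := ⟨fun s ↦ f s, by fun_prop⟩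
  have hf' : ∀ s ∈ Cube.boundary N, f' s = y₀ := fun s hs ↦ congrArg Subtype.val (f.2 s hs)
  obtain ⟨g, hg, hgf, hgB⟩ := exists_contDiff_approx f' y₀ hf' (ε := 1 / 2) (by norm_num)
  obtain ⟨w, hw, hgw⟩ := exists_perturbation_avoiding_line hN hg (y₀ : W) (ε := 1 / 2)
    (by norm_num)
  have hgc := hg.continuous
  let G : C(I^N, W) := ⟨fun s ↦ g (fun i ↦ s i) + (∏ i, (s i : ℝ) * (1 - s i)) • w, by fun_prop⟩
  have hGB : ∀ s ∈ Cube.boundary N, G s = y₀ := by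
    intro s hs
    have : ∏ i, (s i : ℝ) * (1 - s i) = 0 := by
      obtain ⟨i, hi⟩ := hs
      refine Finset.prod_eq_zero (Finset.mem_univ i) ?_
      rcases hi with hi | hi <;> simp [hi]
    simp [G, hgB s hs, this]
  -- The two errors of `1 / 2` stay below the radius of the sphere, so the segment from `f' s` to `G
  -- s` avoids the origin.
  have hGf : ∀ s, ‖G s - f' s‖ < 1 := by
    intro s
    have h1 : ‖g (fun i ↦ s i) - f' s‖ < 1 / 2 := by rw [← dist_eq_norm]; exact hgf s
    have h2 : ‖(∏ i, (s i : ℝ) * (1 - s i)) • w‖ ≤ ‖w‖ := by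
      rw [norm_smul]
      refine mul_le_of_le_one_left (norm_nonneg _) ?_
      rw [Real.norm_eq_abs, Finset.abs_prod]
      refine Finset.prod_le_one (fun _ _ ↦ abs_nonneg _) fun i _ ↦ ?_
      rw [abs_le]
      have := (s i).2.1
      have := (s i).2.2
      constructor <;> nlinarith
    have h3 := norm_add_le (g (fun i ↦ s i) - f' s) ((∏ i, (s i : ℝ) * (1 - s i)) • w)
    have : G s - f' s = (g (fun i ↦ s i) - f' s) + (∏ i, (s i : ℝ) * (1 - s i)) • w := by
      simp only [G, ContinuousMap.coe_mk]; abel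
    rw [this]; linarith
  have hf0 : ∀ s, f' s ≠ 0 := fun s ↦ ne_zero_of_mem_unit_sphere (f s)
  have hfG : ∀ s (t : I), (1 - (t : ℝ)) • f' s + (t : ℝ) • G s ≠ 0 := by
    intro s t h
    have h1 : f' s = -((t : ℝ) • (G s - f' s)) := by
      rw [← sub_eq_zero, ← h]; module
    have h2 : ‖f' s‖ = 1 := norm_eq_of_mem_sphere (f s)
    rw [h1, norm_neg, norm_smul, Real.norm_eq_abs, abs_of_nonneg t.2.1] at h2
    nlinarith [t.2.1, t.2.2, hGf s, norm_nonneg (G s - f' s)]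
  have hG0 : ∀ s, G s ≠ 0 := fun s ↦ by simpa using hfG s 1
  let c : C(I^N, W) := ContinuousMap.const _ (y₀ : W)
  have hc0 : ∀ s, c s ≠ 0 := fun s ↦ ne_zero_of_mem_unit_sphere y₀
  -- A zero on this segment would put `G s` on the line through `y₀`, which `w` excludes in the
  -- interior, or make `y₀` vanish. On the boundary the segment is constant.
  have hGc : ∀ s (t : I), (1 - (t : ℝ)) • G s + (t : ℝ) • c s ≠ 0 := by
    intro s t h
    by_cases hs : s ∈ Cube.boundary N
    · rw [hGB s hs, show c s = y₀ from rfl, ← add_smul] at h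
      simp [ne_zero_of_mem_unit_sphere y₀] at h
    · have hs' : ∀ i, (s i : ℝ) ∈ Set.Ioo (0 : ℝ) 1 := by
        intro i
        refine ⟨lt_of_le_of_ne (s i).2.1 fun h ↦ hs ⟨i, Or.inl ?_⟩,
          lt_of_le_of_ne (s i).2.2 fun h ↦ hs ⟨i, Or.inr ?_⟩⟩
        · exact Subtype.ext h.symm
        · exact Subtype.ext h
      by_cases ht : (1 - (t : ℝ)) = 0
      · rw [ht, zero_smul, zero_add] at h
        have : (t : ℝ) = 1 := by linarith
        rw [this, one_smul] at h
        exact hc0 s h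
      · refine hgw _ hs' (-((1 - (t : ℝ))⁻¹ * t)) ?_
        change G s = _
        have h2 : (1 - (t : ℝ)) • G s = -((t : ℝ) • c s) := eq_neg_of_add_eq_zero_left h
        rw [← inv_smul_smul₀ ht (G s), h2, neg_smul, mul_smul, smul_neg]
        rfl
  have hA := normalizeMap_homotopicRel hf0 hG0 hfG (A := Cube.boundary N)
    fun s hs ↦ (hf' s hs).trans (hGB s hs).symm
  have hB := normalizeMap_homotopicRel hG0 hc0 hGc (A := Cube.boundary N) fun s hs ↦ hGB s hs
  have e1 : normalizeMap f' hf0 = f.1 := by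
    ext s
    simp [f']
  have e2 : normalizeMap c hc0 = (GenLoop.const : Ω^ N (Metric.sphere (0 : W) 1) y₀).1 := by
    ext s
    simp [c]
  have := hA.trans hB
  rwa [e1, e2] at this

end Sphere

/-! ### Functoriality of homotopy groups -/

section InducedMap

variable {N X Y : Type*} [TopologicalSpace X] [TopologicalSpace Y] {x : X} {y : Y}

/-- The generalized loop obtained by composing with a based map. -/
def GenLoop.map (φ : C(X, Y)) (hφ : φ x = y) (f : Ω^ N X x) : Ω^ N Y y :=
  ⟨φ.comp f.1, fun s hs ↦ by rw [ContinuousMap.comp_apply, f.2 s hs, hφ]⟩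

@[simp]
theorem GenLoop.map_apply (φ : C(X, Y)) (hφ : φ x = y) (f : Ω^ N X x) (s : I^N) :
    GenLoop.map φ hφ f s = φ (f s) := rfl

theorem GenLoop.Homotopic.map (φ : C(X, Y)) (hφ : φ x = y) {f g : Ω^ N X x}
    (h : GenLoop.Homotopic f g) :
    GenLoop.Homotopic (GenLoop.map φ hφ f) (GenLoop.map φ hφ g) :=
  h.comp_continuousMap φ

theorem GenLoop.map_const (φ : C(X, Y)) (hφ : φ x = y) :
    GenLoop.map φ hφ (GenLoop.const : Ω^ N X x) = GenLoop.const := by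
  ext s; exact hφ

theorem GenLoop.map_transAt [DecidableEq N] (φ : C(X, Y)) (hφ : φ x = y) (i : N)
    (f g : Ω^ N X x) : GenLoop.map φ hφ (GenLoop.transAt i f g) =
      GenLoop.transAt i (GenLoop.map φ hφ f) (GenLoop.map φ hφ g) := by
  ext s
  simp only [GenLoop.map_apply, GenLoop.transAt, GenLoop.coe_copy]
  split_ifs <;> rfl

/-- The class of a generalized loop in the homotopy group. -/
def HomotopyGroup.mk (f : Ω^ N X x) : HomotopyGroup N X x := Quotient.mk _ f

theorem HomotopyGroup.mk_surjective :
    Function.Surjective (HomotopyGroup.mk : Ω^ N X x → HomotopyGroup N X x) :=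
  Quotient.mk_surjective

theorem HomotopyGroup.mk_eq_mk_iff {f g : Ω^ N X x} :
    HomotopyGroup.mk f = HomotopyGroup.mk g ↔ GenLoop.Homotopic f g :=
  Quotient.eq

theorem HomotopyGroup.mk_mul_mk [DecidableEq N] [Nonempty N] (i : N) (f g : Ω^ N X x) :
    HomotopyGroup.mk f * HomotopyGroup.mk g = HomotopyGroup.mk (GenLoop.transAt i g f) :=
  HomotopyGroup.mul_spec

/-- The homomorphism of homotopy groups induced by a based map. -/
noncomputable def HomotopyGroup.map [DecidableEq N] [Nonempty N] (φ : C(X, Y)) (hφ : φ x = y) :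
    HomotopyGroup N X x →* HomotopyGroup N Y y :=
  MonoidHom.mk' (Quotient.map (GenLoop.map φ hφ) fun _ _ h ↦ h.map φ hφ) (by
    intro a b
    obtain ⟨f, rfl⟩ := HomotopyGroup.mk_surjective a
    obtain ⟨g, rfl⟩ := HomotopyGroup.mk_surjective b
    have i : N := Classical.arbitrary N
    rw [HomotopyGroup.mk_mul_mk i]
    refine (congrArg HomotopyGroup.mk (GenLoop.map_transAt φ hφ i g f)).trans ?_
    exact (HomotopyGroup.mk_mul_mk i _ _).symm)

/-- Homeomorphic spaces have isomorphic homotopy groups. -/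
noncomputable def HomotopyGroup.congrHomeomorph [DecidableEq N] [Nonempty N] (e : X ≃ₜ Y)
    (he : e x = y) : HomotopyGroup N X x ≃* HomotopyGroup N Y y :=
  MonoidHom.toMulEquiv (HomotopyGroup.map (e : C(X, Y)) he)
    (HomotopyGroup.map (e.symm : C(Y, X)) (by simp [← he]))
    (by
      refine MonoidHom.ext fun a ↦ ?_
      obtain ⟨f, rfl⟩ := HomotopyGroup.mk_surjective a
      exact congrArg HomotopyGroup.mk (GenLoop.ext _ _ fun s ↦ e.symm_apply_apply _))
    (by
      refine MonoidHom.ext fun a ↦ ?_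
      obtain ⟨f, rfl⟩ := HomotopyGroup.mk_surjective a
      exact congrArg HomotopyGroup.mk (GenLoop.ext _ _ fun s ↦ e.apply_symm_apply _))

theorem HomotopyGroup.subsingleton_of_homotopic_const
    (h : ∀ f : Ω^ N X x, GenLoop.Homotopic f GenLoop.const) :
    Subsingleton (HomotopyGroup N X x) := by
  refine ⟨fun a b ↦ ?_⟩
  obtain ⟨f, rfl⟩ := HomotopyGroup.mk_surjective a
  obtain ⟨g, rfl⟩ := HomotopyGroup.mk_surjective b
  exact HomotopyGroup.mk_eq_mk_iff.2 ((h f).trans (h g).symm)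

end InducedMap

/-! ### Comparison of homotopy groups along the Hopf map -/

section HopfFibration

variable {V : Type*} [NormedAddCommGroup V] [InnerProductSpace ℂ V]
  {N : Type*} {y₀ : Metric.sphere (0 : V) 1}

/-- A generalized loop in projective space lifts to a map of the cube that is constant on all
faces but one. -/
theorem exists_hopf_lift [DecidableEq N] (i : N) (f : Ω^ N (ℙ ℂ V) (hopf y₀)) :
    ∃ F : C(I^N, Metric.sphere (0 : V) 1), (∀ s, hopf (F s) = f s) ∧
      (∀ s, s i = 0 → F s = y₀) ∧ ∀ s, (∃ k ≠ i, s k = 0 ∨ s k = 1) → F s = y₀ := by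
  -- The homotopy stretches coordinate `i` from `0` to its value. It is stationary where `s i = 0`
  -- and on the faces of the other coordinates, so the lift stays at `y₀` there.
  obtain ⟨F, hF, -, hFs⟩ := exists_homotopy_lift
    (f.1.comp ⟨fun z : (I^N) × I ↦ Function.update z.1 i (z.2 * z.1 i), by fun_prop⟩)
    (ContinuousMap.const _ y₀) (by
      intro s
      refine (f.2 _ ⟨i, Or.inl ?_⟩).symm
      simp)
  refine ⟨F.comp ⟨fun s ↦ (s, 1), by fun_prop⟩, fun s ↦ ?_, fun s hs ↦ ?_, fun s hs ↦ ?_⟩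
  · rw [ContinuousMap.comp_apply, hF]
    simp
  · refine hFs s (fun t ↦ ?_) 1
    simp [hs]
  · obtain ⟨k, hki, hk⟩ := hs
    refine hFs s (fun t ↦ ?_) 1
    refine (f.2 _ ⟨k, ?_⟩).trans (f.2 _ ⟨k, ?_⟩).symm <;>
    simpa [Function.update_of_ne hki] using hk

/-- A map into the fiber of the Hopf map through `y₀` is a rotation of `y₀`. -/
theorem exists_rot_const {Z : Type*} [TopologicalSpace Z] (F : C(Z, Metric.sphere (0 : V) 1))
    (h : ∀ z, hopf (F z) = hopf y₀) :
    ∃ u : C(Z, Circle), (∀ z, (F z : V) = (u z : ℂ) • (y₀ : V)) ∧ ∀ z, F z = y₀ → u z = 1 := by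
  obtain ⟨u, hu⟩ := exists_rot_eq (ContinuousMap.const Z y₀) F fun z ↦ (h z).symm
  have hu' : ∀ z, (F z : V) = (u z : ℂ) • (y₀ : V) := fun z ↦ by rw [← hu]; simp
  refine ⟨u, hu', fun z hz ↦ circle_eq_one_of_smul_eq (v := y₀) ?_⟩
  rw [← hu', hz]

theorem exists_genLoop_hopf_lift [DecidableEq N] (i : N)
    (hi : IsEmpty {k // k ≠ i} ∨ Nontrivial {k // k ≠ i}) (f : Ω^ N (ℙ ℂ V) (hopf y₀)) :
    ∃ F : Ω^ N (Metric.sphere (0 : V) 1) y₀, ∀ s, hopf (F s) = f s := by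
  obtain ⟨F, hF, hF0, hFk⟩ := exists_hopf_lift i f
  obtain ⟨u, hu, hu1⟩ := exists_rot_const (y₀ := y₀) (F.comp
    ⟨fun t : I^{k // k ≠ i} ↦ Cube.insertAt i (1, t), by fun_prop⟩) (by
      intro t
      rw [ContinuousMap.comp_apply, hF]
      exact f.2 _ (Cube.insertAt_boundary i (Or.inl (Or.inr rfl))))
  obtain ⟨θ, hθ, hθ0⟩ := exists_circle_exp_lift_boundary hi u (by
    rintro t ⟨⟨k, hk⟩, hkt⟩
    refine hu1 t (hFk _ ⟨k, hk, ?_⟩)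
    simpa [hk] using hkt)
  -- The factor is `1` where `s i = 0` or `θ = 0`, and cancels the rotation of `F` on the face `s i
  -- = 1`.
  let F' := rot (⟨fun s : I^N ↦ Circle.exp (-((s i : ℝ) * θ fun k ↦ s k)), by fun_prop⟩) F
  have hF' : ∀ s ∈ Cube.boundary N, F' s = y₀ := by
    rintro s ⟨k, hk⟩
    by_cases hJ : ∃ k ≠ i, s k = 0 ∨ s k = 1
    · rw [← hFk s hJ]
      refine rot_eq_of_eq_one ?_
      obtain ⟨k, hki, hk⟩ := hJ
      simp [hθ0 (fun k ↦ s k) ⟨⟨k, hki⟩, hk⟩]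
    obtain rfl : k = i := by
      by_contra hki
      exact hJ ⟨k, hki, hk⟩
    rcases hk with hk | hk
    · rw [← hF0 s hk]
      exact rot_eq_of_eq_one (by simp [hk])
    · have h1 : Cube.insertAt k (1, fun j : {j // j ≠ k} ↦ s j) = s := by
        ext j
        by_cases hj : j = k
        · subst hj; simp [hk]
        · simp [hj]
      have h2 : (F (Cube.insertAt k (1, fun j : {j // j ≠ k} ↦ s j)) : V) = _ := hu fun j ↦ s j
      rw [h1, ← hθ] at h2
      refine rot_eq_of_smul_eq h2 ?_
      simp [hk]
  exact ⟨⟨F', hF'⟩, fun s ↦ (hopf_rot _ _ _).trans (hF s)⟩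

/-- The lifted null-homotopy ends inside one fiber, at a rotation of `y₀` with logarithm `θ`
vanishing on the boundary. Rotating by `-t * θ` at time `t` makes it end at `y₀` and leaves its
start and its boundary alone. -/
theorem homotopic_const_of_map_hopf [Nontrivial N] (F : Ω^ N (Metric.sphere (0 : V) 1) y₀)
    (h : GenLoop.Homotopic (GenLoop.map hopf rfl F : Ω^ N (ℙ ℂ V) (hopf y₀)) GenLoop.const) :
    GenLoop.Homotopic F GenLoop.const := by
  obtain ⟨H⟩ := h
  have hHB : ∀ s ∈ Cube.boundary N, ∀ t, H (t, s) = hopf y₀ := fun s hs t ↦ by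
    rw [H.eq_snd t hs]; rfl
  obtain ⟨G, hG, hG0, hGs⟩ := exists_homotopy_lift
    (⟨fun z : (I^N) × I ↦ H (z.2, z.1), by fun_prop⟩ : C((I^N) × I, ℙ ℂ V)) F.1
    (fun s ↦ (H.apply_zero s).symm)
  have hGB : ∀ s ∈ Cube.boundary N, ∀ t, G (s, t) = y₀ := by
    intro s hs t
    rw [← F.2 s hs]
    exact hGs s (fun t ↦ by simp [hHB s hs]) t
  obtain ⟨u, hu, hu1⟩ := exists_rot_const (y₀ := y₀) (G.comp ⟨fun s : I^N ↦ (s, 1), by fun_prop⟩)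
    (fun s ↦ (hG _).trans (H.apply_one s))
  obtain ⟨θ, hθ, hθ0⟩ := exists_circle_exp_lift_boundary (Or.inr inferInstance) u
    fun s hs ↦ hu1 s (hGB s hs 1)
  let K := rot (⟨fun z : I × (I^N) ↦ Circle.exp (-((z.1 : ℝ) * θ z.2)), by fun_prop⟩)
    (G.comp ⟨fun z : I × (I^N) ↦ (z.2, z.1), by fun_prop⟩)
  refine ⟨⟨⟨K, fun s ↦ ?_, fun s ↦ ?_⟩, fun t s hs ↦ ?_⟩⟩
  · refine (rot_eq_of_eq_one ?_).trans (hG0 s)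
    simp
  · refine rot_eq_of_smul_eq (c := Circle.exp (θ s)) ?_ ?_
    · rw [hθ]; exact hu s
    · simp
  · refine (rot_eq_of_eq_one ?_).trans ((hGB s hs t).trans (F.2 s hs).symm)
    simp [hθ0 s hs]

theorem map_hopf_bijective [DecidableEq N] (i : N) [Nontrivial {k // k ≠ i}] [Nontrivial N] :
    Function.Bijective (HomotopyGroup.map hopf rfl :
      HomotopyGroup N (Metric.sphere (0 : V) 1) y₀ →* HomotopyGroup N (ℙ ℂ V) (hopf y₀)) := by
  constructor
  · rw [injective_iff_map_eq_one]
    intro a ha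
    obtain ⟨F, rfl⟩ := HomotopyGroup.mk_surjective a
    exact HomotopyGroup.mk_eq_mk_iff.2
      (homotopic_const_of_map_hopf F (HomotopyGroup.mk_eq_mk_iff.1 ha))
  · intro a
    obtain ⟨f, rfl⟩ := HomotopyGroup.mk_surjective a
    obtain ⟨F, hF⟩ := exists_genLoop_hopf_lift i (Or.inr inferInstance) f
    exact ⟨HomotopyGroup.mk F, congrArg HomotopyGroup.mk (GenLoop.ext _ _ hF)⟩

end HopfFibration

/-! ### The Hopf degree and the second homotopy group -/

section HopfDegree

variable {V : Type*} [NormedAddCommGroup V] [InnerProductSpace ℂ V]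
  {y₀ : Metric.sphere (0 : V) 1}

/-- A two-dimensional generalized loop in projective space has Hopf degree `k` if it lifts to a
map of the square to the sphere that is constant on three edges and winds `k` times around the
fiber along the fourth. -/
def HasHopfDegree (f : Ω^ (Fin 2) (ℙ ℂ V) (hopf y₀)) (k : ℤ) : Prop :=
  ∃ (F : C(I^(Fin 2), Metric.sphere (0 : V) 1)) (θ : C(I, ℝ)), (∀ s, hopf (F s) = f s) ∧
    (∀ s, s 0 = 0 ∨ s 0 = 1 ∨ s 1 = 0 → F s = y₀) ∧ θ 0 = 0 ∧ θ 1 = k * (2 * Real.pi) ∧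
    ∀ s, s 1 = 1 → (F s : V) = (Circle.exp (θ (s 0)) : ℂ) • (y₀ : V)

theorem exists_hasHopfDegree (f : Ω^ (Fin 2) (ℙ ℂ V) (hopf y₀)) : ∃ k, HasHopfDegree f k := by
  obtain ⟨F, hF, hF0, hFk⟩ := exists_hopf_lift 1 f
  have hFJ : ∀ s, s 0 = 0 ∨ s 0 = 1 ∨ s 1 = 0 → F s = y₀ := by
    rintro s (hs | hs | hs)
    · exact hFk s ⟨0, by decide, Or.inl hs⟩
    · exact hFk s ⟨0, by decide, Or.inr hs⟩
    · exact hF0 s hs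
  obtain ⟨u, hu, hu1⟩ := exists_rot_const (y₀ := y₀)
    (F.comp ⟨fun s : I^(Fin 1) ↦ ![s 0, 1], by fun_prop⟩) (fun s ↦ by
      rw [ContinuousMap.comp_apply, hF]
      exact f.2 _ ⟨1, Or.inr rfl⟩)
  obtain ⟨θ, hθ⟩ := exists_circle_exp_lift u
  have h0 : Circle.exp (θ fun _ ↦ 0) = 1 := by
    rw [hθ]; exact hu1 _ (hFJ _ (Or.inl rfl))
  have h1 : Circle.exp (θ fun _ ↦ 1) = 1 := by
    rw [hθ]; exact hu1 _ (hFJ _ (Or.inr (Or.inl rfl)))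
  obtain ⟨k, hk⟩ := Circle.exp_eq_one.1
    (show Circle.exp (θ (fun _ ↦ 1) - θ fun _ ↦ 0) = 1 by rw [Circle.exp_sub, h0, h1, div_one])
  refine ⟨k, F, ⟨fun t ↦ θ (fun _ ↦ t) - θ fun _ ↦ 0, by fun_prop⟩, hF, hFJ, sub_self _, hk,
    fun s hs ↦ ?_⟩
  have h2 := hu fun _ ↦ s 0
  rw [← hθ] at h2
  have h3 : F ![s 0, 1] = F s := congrArg F (by ext j; fin_cases j <;> simp [hs])
  have h4 : Circle.exp ((θ fun _ ↦ s 0) - θ fun _ ↦ 0) = Circle.exp (θ fun _ ↦ s 0) := by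
    rw [Circle.exp_sub, h0, div_one]
  exact (congrArg Subtype.val h3).symm.trans (h2.trans (by rw [← h4]; rfl))

theorem HasHopfDegree.transAt {f g : Ω^ (Fin 2) (ℙ ℂ V) (hopf y₀)} {k l : ℤ}
    (hf : HasHopfDegree f k) (hg : HasHopfDegree g l) :
    HasHopfDegree (GenLoop.transAt 0 f g) (k + l) := by
  obtain ⟨F, θ, hF, hFJ, hθ0, hθ1, hFθ⟩ := hf
  obtain ⟨G, η, hG, hGJ, hη0, hη1, hGη⟩ := hg
  -- With clamped halves of the parameter, `θ.comp a + η.comp b` runs first through `θ`, then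
  -- through `η`, without case distinction.
  let a : C(I, I) := ⟨fun t ↦ Set.projIcc 0 1 zero_le_one (2 * (t : ℝ)), by fun_prop⟩
  let b : C(I, I) := ⟨fun t ↦ Set.projIcc 0 1 zero_le_one (2 * (t : ℝ) - 1), by fun_prop⟩
  have ha : ∀ t : I, 1 / 2 ≤ (t : ℝ) → a t = 1 := fun t ht ↦
    Set.projIcc_of_right_le zero_le_one (by linarith)
  have hb : ∀ t : I, (t : ℝ) ≤ 1 / 2 → b t = 0 := fun t ht ↦
    Set.projIcc_of_le_left zero_le_one (by linarith)
  have ha0 : a 0 = 0 := Set.projIcc_of_le_left zero_le_one (by simp)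
  have hb1 : b 1 = 1 := Set.projIcc_of_right_le zero_le_one (by norm_num)
  let K : C(I^(Fin 2), Metric.sphere (0 : V) 1) :=
    ⟨fun s ↦ if (s 0 : ℝ) ≤ 1 / 2 then F (Function.update s 0 (a (s 0)))
      else G (Function.update s 0 (b (s 0))), by
      refine Continuous.if_le (by fun_prop) (by fun_prop) (by fun_prop) (by fun_prop)
        fun s hs ↦ ?_
      rw [ha _ hs.ge, hb _ hs.le, hFJ _ (Or.inr (Or.inl (by simp))), hGJ _ (Or.inl (by simp))]⟩
  refine ⟨K, θ.comp a + η.comp b, fun s ↦ ?_, fun s hs ↦ ?_, ?_, ?_, fun s hs ↦ ?_⟩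
  · simp only [K, ContinuousMap.coe_mk, GenLoop.transAt, GenLoop.coe_copy]
    split_ifs
    · exact hF _
    · exact hG _
  · simp only [K, ContinuousMap.coe_mk]
    split_ifs with h
    · refine hFJ _ ?_
      rcases hs with hs | hs | hs
      · simp [hs, ha0]
      · rw [hs] at h; norm_num at h
      · simp [hs]
    · refine hGJ _ ?_
      rcases hs with hs | hs | hs
      · rw [hs] at h; norm_num at h
      · simp [hs, hb1]
      · simp [hs]
  · simp [ha0, hb 0 (by simp), hθ0, hη0]
  · have := ha 1 (by norm_num)
    simp only [ContinuousMap.add_apply, ContinuousMap.comp_apply, this, hb1, hθ1, hη1]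
    push_cast; ring
  · simp only [K, ContinuousMap.coe_mk, ContinuousMap.add_apply, ContinuousMap.comp_apply]
    split_ifs with h
    · rw [hFθ _ (by simpa using hs), hb _ h, hη0]
      simp
    · rw [hGη _ (by simpa using hs), ha _ (not_le.1 h).le, hθ1, Circle.exp_add,
        Circle.exp_int_mul_two_pi]
      simp

/-- The homotopy is stationary on the boundary, hence so is its lift: the winding data `θ` do not
change. -/
theorem HasHopfDegree.of_homotopic {f g : Ω^ (Fin 2) (ℙ ℂ V) (hopf y₀)} {k : ℤ}
    (hf : HasHopfDegree f k) (h : GenLoop.Homotopic f g) : HasHopfDegree g k := by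
  obtain ⟨F, θ, hF, hFJ, hθ0, hθ1, hFθ⟩ := hf
  obtain ⟨H⟩ := h
  obtain ⟨G, hG, -, hGs⟩ := exists_homotopy_lift
    (⟨fun z : (I^(Fin 2)) × I ↦ H (z.2, z.1), by fun_prop⟩ : C((I^(Fin 2)) × I, ℙ ℂ V)) F
    (fun s ↦ (hF s).trans (H.apply_zero s).symm)
  have hGB : ∀ s ∈ Cube.boundary (Fin 2), ∀ t, G (s, t) = F s := fun s hs t ↦
    hGs s (fun t ↦ (H.eq_fst t hs).trans (H.eq_fst 0 hs).symm) t
  refine ⟨G.comp ⟨fun s ↦ (s, 1), by fun_prop⟩, θ, fun s ↦ (hG _).trans (H.apply_one s),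
    fun s hs ↦ ?_, hθ0, hθ1, fun s hs ↦ ?_⟩
  · refine (hGB s ?_ 1).trans (hFJ s hs)
    rcases hs with hs | hs | hs
    exacts [⟨0, Or.inl hs⟩, ⟨0, Or.inr hs⟩, ⟨1, Or.inl hs⟩]
  · rw [← hFθ s hs]
    exact congrArg Subtype.val (hGB s ⟨1, Or.inr hs⟩ 1)

/-- Two lifts differ by a rotation with logarithm `ψ`, which is constant along the three edges where
both are `y₀`. So `ψ` agrees at the ends of the fourth edge, where `θ + ψ - η` is constant. -/
theorem HasHopfDegree.unique {f : Ω^ (Fin 2) (ℙ ℂ V) (hopf y₀)} {k l : ℤ}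
    (hk : HasHopfDegree f k) (hl : HasHopfDegree f l) : k = l := by
  obtain ⟨F, θ, hF, hFJ, hθ0, hθ1, hFθ⟩ := hk
  obtain ⟨G, η, hG, hGJ, hη0, hη1, hGη⟩ := hl
  obtain ⟨u, hu⟩ := exists_rot_eq F G fun s ↦ (hF s).trans (hG s).symm
  obtain ⟨ψ, hψ⟩ := exists_circle_exp_lift u
  have huG : ∀ s, (G s : V) = (u s : ℂ) • (F s : V) := fun s ↦ by rw [← hu, rot_coe]
  have hψJ : ∀ s, s 0 = 0 ∨ s 0 = 1 ∨ s 1 = 0 → Circle.exp (ψ s) = 1 := by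
    intro s hs
    rw [hψ]
    refine circle_eq_one_of_smul_eq (v := y₀) ?_
    have := huG s
    rwa [hFJ s hs, hGJ s hs] at this
  have e1 := eq_of_circle_exp_eq_one (ψ.comp ⟨fun t ↦ ![0, t], by fun_prop⟩)
    fun t ↦ hψJ _ (Or.inl rfl)
  have e2 := eq_of_circle_exp_eq_one (ψ.comp ⟨fun t ↦ ![1, t], by fun_prop⟩)
    fun t ↦ hψJ _ (Or.inr (Or.inl rfl))
  have e3 := eq_of_circle_exp_eq_one (ψ.comp ⟨fun t ↦ ![t, 0], by fun_prop⟩)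
    fun t ↦ hψJ _ (Or.inr (Or.inr rfl))
  have e4 := eq_of_circle_exp_eq_one (θ + ψ.comp ⟨fun t ↦ ![t, 1], by fun_prop⟩ - η) (by
    intro t
    have h := huG ![t, 1]
    rw [hFθ _ rfl, hGη _ rfl, smul_smul, ← hψ, ← Circle.coe_mul] at h
    simp only [ContinuousMap.sub_apply, ContinuousMap.add_apply, ContinuousMap.comp_apply,
      ContinuousMap.coe_mk, Circle.exp_sub, Circle.exp_add]
    refine circle_eq_one_of_smul_eq (v := y₀) ?_
    have h' : (y₀ : V) = (((Circle.exp (η t))⁻¹ : Circle) : ℂ) •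
        ((Circle.exp (η t) : ℂ) • (y₀ : V)) := by
      rw [smul_smul, ← Circle.coe_mul, inv_mul_cancel, Circle.coe_one, one_smul]
    refine h'.trans ((congrArg _ h).trans ?_)
    rw [smul_smul, ← Circle.coe_mul, div_eq_inv_mul, mul_comm (Circle.exp (θ t))]
    rfl)
  simp only [ContinuousMap.sub_apply, ContinuousMap.add_apply, ContinuousMap.comp_apply,
    ContinuousMap.coe_mk, hθ0, hη0, hθ1, hη1] at e1 e2 e3 e4
  have h : ((k : ℝ) - l) * (2 * Real.pi) = 0 := by linarith
  rcases mul_eq_zero.1 h with h | h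
  · exact_mod_cast sub_eq_zero.1 h
  · exact absurd h Real.two_pi_pos.ne'

/-- Degree `0` means `θ` vanishes at both ends, so the unwinding rotation is trivial on the sides of
the square and produces a loop in the sphere over `f`. -/
theorem HasHopfDegree.homotopic_const {f : Ω^ (Fin 2) (ℙ ℂ V) (hopf y₀)}
    (hf : HasHopfDegree f 0)
    (hS : ∀ F : Ω^ (Fin 2) (Metric.sphere (0 : V) 1) y₀, GenLoop.Homotopic F GenLoop.const) :
    GenLoop.Homotopic f GenLoop.const := by
  obtain ⟨F, θ, hF, hFJ, hθ0, hθ1, hFθ⟩ := hf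
  let G := rot (⟨fun s : I^(Fin 2) ↦ Circle.exp (-((s 1 : ℝ) * θ (s 0))), by fun_prop⟩) F
  have hG : ∀ s ∈ Cube.boundary (Fin 2), G s = y₀ := by
    intro s hs
    by_cases hJ : s 0 = 0 ∨ s 0 = 1 ∨ s 1 = 0
    · rw [← hFJ s hJ]
      refine rot_eq_of_eq_one ?_
      rcases hJ with h | h | h <;> simp [h, hθ0, hθ1]
    · have h1 : s 1 = 1 := by
        obtain ⟨j, hj⟩ := hs
        fin_cases j
        · exact absurd (hj.elim Or.inl fun h ↦ Or.inr (Or.inl h)) hJ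
        · exact hj.resolve_left fun h ↦ hJ (Or.inr (Or.inr h))
      refine rot_eq_of_smul_eq (hFθ s h1) ?_
      simp [h1]
  have h := (hS ⟨G, hG⟩).map hopf (rfl : hopf y₀ = hopf y₀)
  rw [GenLoop.map_const] at h
  convert h using 1
  ext s
  exact (hF s).symm.trans (hopf_rot _ _ _).symm

/-- The circle traversed `k` times in a fiber contracts in the sphere; the contraction, read as a
map of the square, projects to the desired loop. -/
theorem exists_hasHopfDegree_eq (k : ℤ)
    (hS : ∀ F : Ω^ (Fin 1) (Metric.sphere (0 : V) 1) y₀, GenLoop.Homotopic F GenLoop.const) :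
    ∃ f : Ω^ (Fin 2) (ℙ ℂ V) (hopf y₀), HasHopfDegree f k := by
  let γ := rot (⟨fun s : I^(Fin 1) ↦ Circle.exp ((s 0 : ℝ) * (k * (2 * Real.pi))),
    by fun_prop⟩) (ContinuousMap.const _ y₀)
  have hγ : ∀ s ∈ Cube.boundary (Fin 1), γ s = y₀ := by
    rintro s ⟨j, hj⟩
    obtain rfl : j = 0 := Subsingleton.elim _ _
    refine rot_eq_of_eq_one ?_
    rcases hj with hj | hj <;> simp [hj]
  obtain ⟨H⟩ := (hS ⟨γ, hγ⟩).symm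
  let F : C(I^(Fin 2), Metric.sphere (0 : V) 1) := ⟨fun s ↦ H (s 1, fun _ ↦ s 0), by fun_prop⟩
  have hFJ : ∀ s, s 0 = 0 ∨ s 0 = 1 ∨ s 1 = 0 → F s = y₀ := by
    intro s hs
    rw [← or_assoc] at hs
    rcases hs with hs | hs
    · exact H.eq_fst (s 1) ⟨0, hs⟩
    · refine Eq.trans ?_ (H.apply_zero fun _ ↦ s 0)
      change H (s 1, _) = _
      rw [hs]
  have hF1 : ∀ s, s 1 = 1 → F s = γ fun _ ↦ s 0 := by
    intro s hs
    refine Eq.trans ?_ (H.apply_one fun _ ↦ s 0)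
    change H (s 1, _) = _
    rw [hs]
  refine ⟨⟨hopf.comp F, ?_⟩, F, ⟨fun t ↦ t * (k * (2 * Real.pi)), by fun_prop⟩, fun s ↦ rfl, hFJ,
    by simp, by simp, fun s hs ↦ ?_⟩
  · rintro s ⟨j, hj⟩
    fin_cases j
    · exact congrArg hopf (hFJ s (hj.elim Or.inl fun h ↦ Or.inr (Or.inl h)))
    · rcases hj with hj | hj
      · exact congrArg hopf (hFJ s (Or.inr (Or.inr hj)))
      · exact (congrArg hopf (hF1 s hj)).trans (hopf_rot _ _ _)
  · rw [hF1 s hs]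
    rfl

/-- The second homotopy group of a projective space whose unit sphere has trivial first and second
homotopy groups is infinite cyclic. -/
theorem nonempty_pi_two_projectivization_mulEquiv
    (hS₁ : ∀ F : Ω^ (Fin 1) (Metric.sphere (0 : V) 1) y₀, GenLoop.Homotopic F GenLoop.const)
    (hS₂ : ∀ F : Ω^ (Fin 2) (Metric.sphere (0 : V) 1) y₀, GenLoop.Homotopic F GenLoop.const) :
    Nonempty (π_ 2 (ℙ ℂ V) (hopf y₀) ≃* Multiplicative ℤ) := by
  choose d hd using exists_hasHopfDegree (y₀ := y₀)
  have hd' : ∀ f g, GenLoop.Homotopic f g → d f = d g := fun f g h ↦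
    ((hd f).of_homotopic h).unique (hd g)
  let D : π_ 2 (ℙ ℂ V) (hopf y₀) → Multiplicative ℤ :=
    Quotient.lift (fun f ↦ Multiplicative.ofAdd (d f)) fun f g h ↦
      congrArg Multiplicative.ofAdd (hd' f g h)
  have hD : ∀ f, D (HomotopyGroup.mk f) = Multiplicative.ofAdd (d f) := fun _ ↦ rfl
  let Dh : π_ 2 (ℙ ℂ V) (hopf y₀) →* Multiplicative ℤ := MonoidHom.mk' D (by
    intro a b
    obtain ⟨f, rfl⟩ := HomotopyGroup.mk_surjective a
    obtain ⟨g, rfl⟩ := HomotopyGroup.mk_surjective b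
    -- Multiplication of classes concatenates in reverse order, which commutativity of `ℤ` absorbs.
    rw [HomotopyGroup.mk_mul_mk 0, hD, hD, hD, mul_comm, ← ofAdd_add]
    exact congrArg Multiplicative.ofAdd ((hd _).unique ((hd g).transAt (hd f))))
  refine ⟨MulEquiv.ofBijective Dh ⟨?_, fun k ↦ ?_⟩⟩
  · rw [injective_iff_map_eq_one]
    intro a ha
    obtain ⟨f, rfl⟩ := HomotopyGroup.mk_surjective a
    have h0 : d f = 0 := ha
    have := hd f
    rw [h0] at this
    exact HomotopyGroup.mk_eq_mk_iff.2 (this.homotopic_const hS₂)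
  · obtain ⟨f, hf⟩ := exists_hasHopfDegree_eq (Multiplicative.toAdd k) hS₁
    exact ⟨HomotopyGroup.mk f, congrArg Multiplicative.ofAdd ((hd f).unique hf)⟩

end HopfDegree

/-! ### Assembly for complex projective space -/

section Main

/-- Real inner product spaces of the same finite dimension have homeomorphic unit spheres, with
prescribed image of a given point. -/
theorem exists_homeomorph_sphere {E E' : Type*} [NormedAddCommGroup E] [InnerProductSpace ℝ E]
    [FiniteDimensional ℝ E] [NormedAddCommGroup E'] [InnerProductSpace ℝ E']
    [FiniteDimensional ℝ E'] (h : Module.finrank ℝ E = Module.finrank ℝ E')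
    (x : Metric.sphere (0 : E) 1) (y : Metric.sphere (0 : E') 1) :
    ∃ e : Metric.sphere (0 : E) 1 ≃ₜ Metric.sphere (0 : E') 1, e x = y := by
  let L : E ≃ₗᵢ[ℝ] E' := (stdOrthonormalBasis ℝ E).equiv (stdOrthonormalBasis ℝ E') (finCongr h)
  let R : E' ≃ₗᵢ[ℝ] E' := (ℝ ∙ (L x - y))ᗮ.reflection
  have hR : R (L x) = y := Submodule.reflection_sub (by simp)
  let A : E ≃ₗᵢ[ℝ] E' := L.trans R
  refine ⟨A.toHomeomorph.subtype fun v ↦ ?_, Subtype.ext hR⟩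
  simp

theorem mainTheorem5 (n : ℕ) (hn : 1 ≤ n) (x : ComplexProjectiveSpace n) :
    (∀ j : ℕ, j < 2 → Subsingleton (π_ j (ComplexProjectiveSpace n) x)) ∧
    Nonempty (π_ 2 (ComplexProjectiveSpace n) x ≃* Multiplicative ℤ) ∧
    (∀ (j : ℕ) [NeZero j], 2 < j → ∀ y : StandardSphere (2 * n + 1),
      Nonempty (π_ j (ComplexProjectiveSpace n) x ≃* π_ j (StandardSphere (2 * n + 1)) y)) := by
  obtain ⟨y₀, rfl⟩ := hopf_surjective x
  have hrank : Module.finrank ℝ (EuclideanSpace ℂ (Fin (n + 1))) = 2 * (n + 1) := by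
    rw [← Module.finrank_mul_finrank ℝ ℂ]
    simp
  -- Here `n ≥ 1` enters: `j + 1 ≤ 3 < 2 * (n + 1)`.
  have hS : ∀ j ≤ 2, ∀ F : Ω^ (Fin j) (Metric.sphere (0 : EuclideanSpace ℂ (Fin (n + 1))) 1) y₀,
      GenLoop.Homotopic F GenLoop.const := fun j hj F ↦
    genLoop_sphere_homotopic_const (by rw [hrank, Fintype.card_fin]; omega) F
  refine ⟨fun j hj ↦ ?_, nonempty_pi_two_projectivization_mulEquiv (hS 1 (by norm_num))
    (hS 2 le_rfl), fun j _ hj y ↦ ?_⟩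
  · interval_cases j
    · have : PathConnectedSpace (Metric.sphere (0 : EuclideanSpace ℂ (Fin (n + 1))) 1) := by
        refine isPathConnected_iff_pathConnectedSpace.1
          (isPathConnected_sphere ?_ _ zero_le_one)
        rw [← Module.finrank_eq_rank, hrank]
        norm_cast
        omega
      have : PathConnectedSpace (ComplexProjectiveSpace n) :=
        hopf_surjective.pathConnectedSpace hopf.continuous
      have : Subsingleton (ZerothHomotopy (ComplexProjectiveSpace n)) :=
        (pathConnectedSpace_iff_zerothHomotopy.1 this).2
      exact HomotopyGroup.pi0EquivZerothHomotopy.subsingleton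
    · refine HomotopyGroup.subsingleton_of_homotopic_const fun f ↦ ?_
      -- The last face of a `1`-cube is a point, so there is no winding obstruction.
      obtain ⟨F, hF⟩ := exists_genLoop_hopf_lift 0
        (Or.inl ⟨fun k ↦ k.2 (Subsingleton.elim _ _)⟩) f
      have h := (hS 1 (by norm_num) F).map hopf rfl
      rw [GenLoop.map_const] at h
      rwa [show GenLoop.map hopf rfl F = f from GenLoop.ext _ _ hF] at h
  · obtain ⟨m, rfl⟩ : ∃ m, j = m + 3 := ⟨j - 3, by omega⟩
    have : Nontrivial {k : Fin (m + 3) // k ≠ 0} :=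
      ⟨⟨⟨1, by omega⟩, by simp⟩, ⟨⟨2, by omega⟩, by simp [Fin.ext_iff]⟩,
        by simp⟩
    obtain ⟨e, he⟩ := exists_homeomorph_sphere (by rw [hrank]; simp; ring) y₀ y
    exact ⟨(MulEquiv.ofBijective _ (map_hopf_bijective (y₀ := y₀) (0 : Fin (m + 3)))).symm.trans
      (HomotopyGroup.congrHomeomorph e he)⟩

end Main
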